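/- Let $X_0=0$ and let $X_1,X_2,\ldots$ be independent random variables with $\mathbb{P}\{X_i=1\}=\mathbb{P}\{X_i=-1\}=\tfrac12$. Define the symmetric random walk with weak reflection at the origin by $S_0=0$ and $S_j=\max\{S_{j-1}+X_j,\,0\}$ for $j\ge 1$, and let $M_n=\max_{0\le j\le n}S_j$. Then $M_n$ and $M_n^2$ are integrable and, as $n\to\infty$, $$\mathbb{E}(M_n)\sim\sqrt{\frac{\pi n}{2}},\qquad \mathbb{E}(M_n^2)\sim 2G\,n,$$ where $G=\sum_{k=0}^{\infty}\frac{(-1)^k}{(2k+1)^2}$ is Catalan's constant. Moreover, the limits of $\mathbb{E}(M_n)/\sqrt n$ and $\mathbb{E}(M_n^2)/n$ also exist in the sense of Abel summation, with the same values: the power series $\sum_{n\ge1}\lambda^{n}\mathbb{E}(M_n)$ and $\sum_{n\ge1}\lambda^{n}\mathbb{E}(M_n^2)$ converge for $0<\lambda<1$, and $$\lim_{\lambda\to1^-}(1-\lambda)^{3/2}\sum_{n=1}^{\infty}\frac{\lambda^{n-1/2}}{\Gamma(3/2)}\,\mathbb{E}(M_n)=\sqrt{\frac{\pi}{2}},\qquad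 \lim_{\lambda\to1^-}(1-\lambda)^{2}\sum_{n=1}^{\infty}\lambda^{n-1}\,\mathbb{E}(M_n^2)=2G.$$ -/

import Mathlib

open MeasureTheory ProbabilityTheory Filter Topology Asymptotics

/-- The random walk with weak reflection at the origin driven by the steps `X 1, X 2, …`:
`S 0 = X 0` and `S j = max (S (j - 1) + X j) 0` for `j ≥ 1`. -/
def weakWalk {Ω : Type*} (X : ℕ → Ω → ℤ) : ℕ → Ω → ℤ
  | 0, ω => X 0 ω
  | j + 1, ω => max (weakWalk X j ω + X (j + 1) ω) 0

/-- The maximum `M n = max (S 0, …, S n)` of the weakly reflected walk. -/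
def weakMax {Ω : Type*} (X : ℕ → Ω → ℤ) (n : ℕ) (ω : Ω) : ℤ :=
  (Finset.range (n + 1)).sup' Finset.nonempty_range_add_one (fun j => weakWalk X j ω)

/-- Catalan's constant `G = 1 - 1/9 + 1/25 - ⋯`. -/
noncomputable def catalanConstant : ℝ :=
  ∑' k : ℕ, (-1 : ℝ) ^ k / (2 * (k : ℝ) + 1) ^ 2

/-- `L` is the limit of `u n / n ^ α` in the sense of Abel summation: the power series
`∑_{n ≥ 1} u n * r ^ n` converges for `0 < r < 1`, and
`(1 - r) ^ (α + 1) * ∑_{n ≥ 1} r ^ (n - α) * u n / Γ(α + 1) → L` as `r` increases to `1`. -/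
def HasAbelLimit (α : ℝ) (u : ℕ → ℝ) (L : ℝ) : Prop :=
  (∀ r : ℝ, 0 < r → r < 1 → Summable fun n : ℕ => r ^ (n + 1) * u (n + 1)) ∧
  Tendsto
    (fun r : ℝ => (1 - r) ^ (α + 1) *
      ∑' n : ℕ, 1 / Real.Gamma (α + 1) * r ^ (((n + 1 : ℕ) : ℝ) - α) * u (n + 1))
    (𝓝[<] 1) (𝓝 L)

/-! The event `M_n < m` concerns a walk reflected at the origin and killed on reaching `m`. Unfold
it by the method of images: `squareWave m` equals 1 on the allowed states `0, …, m - 1`, is even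
about `-1/2` (weak reflection identifies `-1` with `0`) and odd about `m` (killing). The averaging
operator `stepAvg` preserves both symmetries, so `P(M_n < m)` is the mean of `squareWave m` at the
free symmetric walk `Y_n` started from 0 (`integral_weakMax_lt`).

Summing the tails with weights `(m + 1)^p - m^p` gives the exact identity `E(M_n^p) = E(waveMoment p
(Y_n))` (`integral_weakMax_pow`). Exchanging two sums turns `waveMoment` into alternating sums of
powers of floors, whence `waveMoment p y ~ 2 c_p |y|^p` with `c_p = ∑ (-1)^j / (2j+1)^p`, that is,
`c_1 = π/4` and `c_2 = G` (`tendsto_waveMoment_div`).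

Since `E|Y_n| ~ √(2n/π)` by Wallis and `E(Y_n^2) = n`, and since asymptotic proportionality survives
averaging (`tendsto_stepAvg_pow_div`), the two moments are asymptotic to `√(πn/2)` and `2Gn`. The
Abel limits then follow from an Abelian theorem (`hasAbelLimit_of_tendsto`). -/

/-! ### Abelian theorem via the binomial series -/

/-- The coefficients of the power series of `(1 - r) ^ (-s)`. -/
noncomputable def binomCoeff (s : ℝ) (n : ℕ) : ℝ :=
  (∏ i ∈ Finset.range n, (s + i)) / n.factorial

lemma binomCoeff_pos {s : ℝ} (hs : 0 < s) (n : ℕ) : 0 < binomCoeff s n := by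
  unfold binomCoeff
  have : 0 < ∏ i ∈ Finset.range n, (s + i) := Finset.prod_pos fun i _ => by positivity
  positivity

lemma binomCoeff_eq_choose (s : ℝ) (n : ℕ) : binomCoeff s n = Ring.choose (s + n - 1) n := by
  have h := Ring.factorial_nsmul_multichoose_eq_ascPochhammer s n
  rw [Ring.multichoose_eq, Polynomial.ascPochhammer_smeval_eq_eval, nsmul_eq_mul] at h
  have h2 : (ascPochhammer ℝ n).eval s = ∏ i ∈ Finset.range n, (s + i) := by
    clear h
    induction n with
    | zero => simp
    | succ n ih => rw [ascPochhammer_succ_eval, Finset.prod_range_succ, ih]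
  rw [h2] at h
  rw [binomCoeff, ← h, mul_div_cancel_left₀ _ (by positivity)]

lemma hasSum_binomCoeff (s : ℝ) {r : ℝ} (hr : |r| < 1) :
    HasSum (fun n => binomCoeff s n * r ^ n) (1 / (1 - r) ^ s) := by
  have h := (Real.one_div_one_sub_rpow_hasFPowerSeriesOnBall_zero s).hasSum
    (y := r) (by simpa [enorm_eq_nnnorm] using! hr)
  simpa [binomCoeff_eq_choose, FormalMultilinearSeries.ofScalars] using h

/-- This is Euler's limit for Gamma: the ratio differs from `GammaSeq` only by the last factor `(a +
1 + n) / n`, which tends to 1. -/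
lemma tendsto_binomCoeff_div_rpow {a : ℝ} (ha : 0 < a + 1) :
    Tendsto (fun n : ℕ => (n : ℝ) ^ a / binomCoeff (a + 1) n) atTop (𝓝 (Real.Gamma (a + 1))) := by
  have h := Real.GammaSeq_tendsto_Gamma (a + 1)
  have h2 : Tendsto (fun n : ℕ => (a + 1 + n) / (n : ℝ)) atTop (𝓝 (0 + 1)) := by
    refine ((tendsto_const_nhds (x := a + 1)).div_atTop tendsto_natCast_atTop_atTop).add
      (tendsto_const_nhds (x := (1 : ℝ))) |>.congr' ?_
    filter_upwards [eventually_gt_atTop 0] with n hn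
    field_simp
  have h3 := h.mul h2
  rw [zero_add, mul_one] at h3
  refine h3.congr' ?_
  filter_upwards [eventually_gt_atTop 0] with n hn
  have hn' : (0 : ℝ) < n := by exact_mod_cast hn
  have hp : 0 < ∏ i ∈ Finset.range n, (a + 1 + i) := Finset.prod_pos fun i _ => by positivity
  have : 0 < a + 1 + n := by positivity
  rw [Real.GammaSeq, binomCoeff, Finset.prod_range_succ, Real.rpow_add hn', Real.rpow_one]
  field_simp

/-- An Abelian theorem for power series compared with the binomial series. -/
lemma tendsto_tsum_of_tendsto_div_binomCoeff {s : ℝ} (hs : 0 < s) {u : ℕ → ℝ} {L : ℝ}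
    (h : Tendsto (fun n => u n / binomCoeff s n) atTop (𝓝 L)) :
    (∀ r : ℝ, 0 < r → r < 1 → Summable fun n => r ^ n * u n) ∧
      Tendsto (fun r : ℝ => (1 - r) ^ s * ∑' n, r ^ n * u n) (𝓝[<] 1) (𝓝 L) := by
  have hb := binomCoeff_pos hs
  -- The finitely many exceptional indices enter as an explicit error term; their total contribution
  -- stays bounded as `r → 1` and is killed by `(1 - r) ^ s`.
  have hev : ∀ ε > 0, ∃ C, ∀ n, |u n - L * binomCoeff s n| ≤ ε * binomCoeff s n +
      if n < C then |u n - L * binomCoeff s n| else 0 := by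
    intro ε hε
    obtain ⟨N, hN⟩ := (Metric.tendsto_atTop.1 h) ε hε
    refine ⟨N, fun n => ?_⟩
    split_ifs with hn
    · have := hb n
      have : 0 ≤ ε * binomCoeff s n := by positivity
      linarith
    · have h1 := hN n (not_lt.1 hn)
      have hbn := hb n
      rw [Real.dist_eq, div_sub' hbn.ne', abs_div, abs_of_pos hbn, div_lt_iff₀ hbn] at h1
      rw [mul_comm L]
      linarith
  have hsb : ∀ r : ℝ, 0 < r → r < 1 → HasSum (fun n => r ^ n * binomCoeff s n) (1 / (1 - r) ^ s) :=
    fun r h0 h1 => by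
      simpa [mul_comm] using hasSum_binomCoeff s (abs_lt.2 ⟨by linarith, h1⟩)
  have hfin : ∀ (r : ℝ) (N : ℕ), HasSum
      (fun n => r ^ n * if n < N then |u n - L * binomCoeff s n| else 0)
      (∑ n ∈ Finset.range N, r ^ n * if n < N then |u n - L * binomCoeff s n| else 0) :=
    fun r N => hasSum_sum_of_ne_finset_zero fun n hn => by
      rw [if_neg (by simpa using hn), mul_zero]
  have hd : ∀ r : ℝ, 0 < r → r < 1 → ∀ ε > 0, ∀ N, (∀ n, |u n - L * binomCoeff s n| ≤
      ε * binomCoeff s n + if n < N then |u n - L * binomCoeff s n| else 0) →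
      (Summable fun n => r ^ n * (u n - L * binomCoeff s n)) ∧
      |∑' n, r ^ n * (u n - L * binomCoeff s n)| ≤ ε * (1 / (1 - r) ^ s) +
        ∑ n ∈ Finset.range N, |u n - L * binomCoeff s n| := by
    intro r h0 h1 ε hε N hN
    have hsum := ((hsb r h0 h1).mul_left ε).add (hfin r N)
    have hle : ∀ n, ‖r ^ n * (u n - L * binomCoeff s n)‖ ≤ ε * (r ^ n * binomCoeff s n) +
        r ^ n * if n < N then |u n - L * binomCoeff s n| else 0 := by
      intro n
      rw [norm_mul, Real.norm_eq_abs, Real.norm_eq_abs, abs_of_pos (pow_pos h0 n)]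
      calc _ ≤ _ := mul_le_mul_of_nonneg_left (hN n) (pow_pos h0 n).le
        _ = _ := by ring
    refine ⟨Summable.of_norm_bounded hsum.summable hle, ?_⟩
    refine (tsum_of_norm_bounded hsum hle).trans (add_le_add le_rfl ?_)
    refine Finset.sum_le_sum fun n hn => ?_
    rw [if_pos (by simpa using hn)]
    exact mul_le_of_le_one_left (abs_nonneg _) (pow_le_one₀ h0.le h1.le)
  have hsplit : ∀ r : ℝ, 0 < r → r < 1 → HasSum (fun n => r ^ n * u n)
      (∑' n, r ^ n * (u n - L * binomCoeff s n) + L * (1 / (1 - r) ^ s)) := by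
    intro r h0 h1
    obtain ⟨N, hN⟩ := hev 1 one_pos
    refine ((hd r h0 h1 1 one_pos N hN).1.hasSum.add ((hsb r h0 h1).mul_left L)).congr_fun
      fun n => ?_
    ring
  refine ⟨fun r h0 h1 => (hsplit r h0 h1).summable, ?_⟩
  rw [Metric.tendsto_nhds]
  intro ε hε
  obtain ⟨N, hN⟩ := hev (ε / 2) (by positivity)
  set C := ∑ n ∈ Finset.range N, |u n - L * binomCoeff s n| with hC
  have hlim : Tendsto (fun r : ℝ => (1 - r) ^ s * C) (𝓝[<] 1) (𝓝 0) := by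
    have : ContinuousAt (fun r : ℝ => (1 - r) ^ s * C) 1 := by
      refine ContinuousAt.mul (ContinuousAt.rpow_const (by fun_prop) (Or.inr hs.le))
        continuousAt_const
    have h2 := this.tendsto
    rw [sub_self, Real.zero_rpow hs.ne', zero_mul] at h2
    exact h2.mono_left nhdsWithin_le_nhds
  filter_upwards [hlim.eventually (gt_mem_nhds (half_pos hε)),
    Ioo_mem_nhdsLT (show (0 : ℝ) < 1 by norm_num)] with r hr hr01
  have hpos : 0 < (1 - r) ^ s := Real.rpow_pos_of_pos (by linarith [hr01.2]) _
  have hb2 := (hd r hr01.1 hr01.2 (ε / 2) (by positivity) N hN).2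
  rw [(hsplit r hr01.1 hr01.2).tsum_eq, Real.dist_eq]
  have : (1 - r) ^ s * (∑' n, r ^ n * (u n - L * binomCoeff s n) + L * (1 / (1 - r) ^ s)) - L
      = (1 - r) ^ s * ∑' n, r ^ n * (u n - L * binomCoeff s n) := by
    field_simp
    ring
  rw [this, abs_mul, abs_of_pos hpos]
  calc _ ≤ (1 - r) ^ s * (ε / 2 * (1 / (1 - r) ^ s) + C) := by gcongr
    _ = ε / 2 + (1 - r) ^ s * C := by field_simp
    _ < ε := by linarith

/-- An ordinary limit of `u n / n ^ a` is also a limit in the sense of Abel summation. -/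
lemma hasAbelLimit_of_tendsto {a : ℝ} (ha : 0 ≤ a) {u : ℕ → ℝ} {L : ℝ}
    (h : Tendsto (fun n : ℕ => u n / (n : ℝ) ^ a) atTop (𝓝 L)) : HasAbelLimit a u L := by
  have hG : 0 < Real.Gamma (a + 1) := Real.Gamma_pos_of_pos (by linarith)
  have h1 : Tendsto (fun n => u n / binomCoeff (a + 1) n) atTop (𝓝 (L * Real.Gamma (a + 1))) := by
    refine (h.mul (tendsto_binomCoeff_div_rpow (by linarith))).congr' ?_
    filter_upwards [eventually_gt_atTop 0] with n hn
    have : (0 : ℝ) < (n : ℝ) ^ a := by positivity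
    field_simp
  obtain ⟨hs, hl⟩ := tendsto_tsum_of_tendsto_div_binomCoeff (by linarith) h1
  refine ⟨fun r h0 h1 => (summable_nat_add_iff 1).2 (hs r h0 h1), ?_⟩
  -- The Abel sum starts at `n = 1`; the omitted term `u 0` is negligible.
  have hc : Tendsto (fun r : ℝ => (1 - r) ^ (a + 1) * u 0) (𝓝[<] 1) (𝓝 0) := by
    have : ContinuousAt (fun r : ℝ => (1 - r) ^ (a + 1) * u 0) 1 := by
      refine ContinuousAt.mul (ContinuousAt.rpow_const (by fun_prop) (Or.inr (by linarith)))
        continuousAt_const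
    have h2 := this.tendsto
    rw [sub_self, Real.zero_rpow (by linarith), zero_mul] at h2
    exact h2.mono_left nhdsWithin_le_nhds
  have hr : Tendsto (fun r : ℝ => 1 / Real.Gamma (a + 1) * r ^ (-a)) (𝓝[<] 1)
      (𝓝 (1 / Real.Gamma (a + 1))) := by
    have : ContinuousAt (fun r : ℝ => 1 / Real.Gamma (a + 1) * r ^ (-a)) 1 :=
      continuousAt_const.mul (ContinuousAt.rpow_const (by fun_prop) (Or.inl one_ne_zero))
    have h2 := this.tendsto
    rw [Real.one_rpow, mul_one] at h2
    exact h2.mono_left nhdsWithin_le_nhds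
  have := hr.mul (hl.sub hc)
  rw [sub_zero, show 1 / Real.Gamma (a + 1) * (L * Real.Gamma (a + 1)) = L by field_simp] at this
  refine this.congr' ?_
  filter_upwards [Ioo_mem_nhdsLT (show (0 : ℝ) < 1 by norm_num)] with r hr01
  have hshift := (hs r hr01.1 hr01.2).tsum_eq_zero_add
  have : ∀ n : ℕ, 1 / Real.Gamma (a + 1) * r ^ (((n + 1 : ℕ) : ℝ) - a) * u (n + 1) =
      1 / Real.Gamma (a + 1) * r ^ (-a) * (r ^ (n + 1) * u (n + 1)) := by
    intro n
    rw [sub_eq_add_neg, Real.rpow_add hr01.1, Real.rpow_natCast]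
    ring
  simp_rw [this, tsum_mul_left, hshift]
  simp only [pow_zero, one_mul]
  ring

/-! ### The square wave and its symmetries -/

/-- The square wave that is `1` on `[-m, m - 1]`, `0` at `m` and at `-m - 1`, symmetric about
`-1/2` and antisymmetric about `m`. -/
noncomputable def squareWave (m : ℕ) (y : ℤ) : ℝ :=
  ((-1 : ℝ) ^ ((y + m + 1) / (2 * m + 1)) + (-1 : ℝ) ^ ((y + m) / (2 * m + 1))) / 2

/-- Writing `a = q * d + r`, the complementary remainder `d - 1 - r` again lies in `[0, d)`, so the
quotient is negated exactly. -/
lemma Int.sub_one_sub_ediv (a d : ℤ) (hd : 0 < d) : (d - 1 - a) / d = -(a / d) := by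
  rw [Int.ediv_eq_iff_of_pos hd]
  have h1 := Int.emod_add_mul_ediv a d
  have h2 := Int.emod_nonneg a hd.ne'
  have h3 := Int.emod_lt_of_pos a hd
  constructor <;> nlinarith

lemma squareWave_neg_one_sub (m : ℕ) (y : ℤ) : squareWave m (-1 - y) = squareWave m y := by
  have hd : (0 : ℤ) < 2 * m + 1 := by positivity
  have h1 : (-1 - y + m + 1) / (2 * m + 1) = -((y + m) / (2 * m + 1) : ℤ) := by
    rw [← Int.sub_one_sub_ediv _ _ hd]; congr 1; ring
  have h2 : (-1 - y + m) / (2 * m + 1) = -((y + m + 1) / (2 * m + 1) : ℤ) := by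
    rw [← Int.sub_one_sub_ediv _ _ hd]; congr 1; ring
  rw [squareWave, h1, h2, squareWave, add_comm]
  simp [zpow_neg, ← inv_zpow]

lemma squareWave_two_mul_sub (m : ℕ) (y : ℤ) : squareWave m (2 * m - y) = -squareWave m y := by
  have hd : (0 : ℤ) < 2 * m + 1 := by positivity
  have h1 : (2 * m - y + m + 1) / (2 * m + 1) = 1 + -((y + m) / (2 * m + 1) : ℤ) := by
    rw [← Int.sub_one_sub_ediv _ _ hd, add_comm 1, ← Int.add_mul_ediv_left _ 1 hd.ne']
    congr 1; ring
  have h2 : (2 * m - y + m) / (2 * m + 1) = 1 + -((y + m + 1) / (2 * m + 1) : ℤ) := by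
    rw [← Int.sub_one_sub_ediv _ _ hd, add_comm 1, ← Int.add_mul_ediv_left _ 1 hd.ne']
    congr 1; ring
  rw [squareWave, h1, h2, squareWave, zpow_add₀ (by norm_num), zpow_add₀ (by norm_num)]
  simp only [zpow_neg, ← inv_zpow, zpow_one]
  norm_num
  ring

lemma squareWave_of_lt {m : ℕ} {y : ℤ} (h0 : 0 ≤ y) (h : y < m) : squareWave m y = 1 := by
  rw [squareWave, Int.ediv_eq_zero_of_lt (by omega) (by omega),
    Int.ediv_eq_zero_of_lt (by omega) (by omega)]
  norm_num

lemma abs_squareWave_le (m : ℕ) (y : ℤ) : |squareWave m y| ≤ 1 := by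
  rw [squareWave, abs_div, abs_two, div_le_one two_pos]
  refine (abs_add_le _ _).trans ?_
  simp [abs_zpow]
  norm_num

/-! ### Summing square waves into alternating floor sums -/

lemma one_sub_neg_one_pow (q : ℕ) :
    (1 - (-1 : ℝ) ^ q) / 2 = ∑ j ∈ Finset.range q, (-1 : ℝ) ^ j := by
  induction q with
  | zero => simp
  | succ q ih => rw [Finset.sum_range_succ, ← ih, pow_succ]; ring

/-- The alternating sum `∑ (-1) ^ j * ⌊(w - j - 1) / (2 * j + 1)⌋ ^ p`. -/
noncomputable def altFloorSum (p w : ℕ) : ℝ :=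
  ∑ j ∈ Finset.range w, (-1 : ℝ) ^ j * (((w - (j + 1)) / (2 * j + 1) : ℕ) : ℝ) ^ p

lemma sum_neg_one_pow_eq_altFloorSum {p w n : ℕ} (hp : p ≠ 0) (hn : w ≤ n) :
    ∑ m ∈ Finset.range n, (((m + 1 : ℕ) : ℝ) ^ p - (m : ℝ) ^ p) *
      ((1 - (-1 : ℝ) ^ ((w + m + 1) / (2 * m + 3))) / 2) = altFloorSum p w := by
  -- Both conditions say `2mj + 3j + m + 2 ≤ w`. This permits exchanging the sums over `m` and `j`,
  -- after which the weights telescope.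
  have key : ∀ m j : ℕ, j < (w + m + 1) / (2 * m + 3) ↔ m < (w - (j + 1)) / (2 * j + 1) := by
    intro m j
    rw [← Nat.add_one_le_iff, Nat.le_div_iff_mul_le (by omega), ← Nat.add_one_le_iff (n := m),
      Nat.le_div_iff_mul_le (by omega)]
    have : (j + 1) * (2 * m + 3) = 2 * (m * j) + 3 * j + 2 * m + 3 := by ring
    have : (m + 1) * (2 * j + 1) = 2 * (m * j) + m + 2 * j + 1 := by ring
    omega
  have hle : ∀ m, (w + m + 1) / (2 * m + 3) ≤ w := by
    intro m
    by_contra! h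
    have := (Nat.le_div_iff_mul_le (by omega)).1 (Nat.add_one_le_iff.2 h)
    nlinarith
  have h1 : ∀ m, (1 - (-1 : ℝ) ^ ((w + m + 1) / (2 * m + 3))) / 2 =
      ∑ j ∈ Finset.range w, if m < (w - (j + 1)) / (2 * j + 1) then (-1 : ℝ) ^ j else 0 := by
    intro m
    rw [one_sub_neg_one_pow, ← Finset.sum_filter]
    refine Finset.sum_congr ?_ fun _ _ => rfl
    ext j
    have := hle m
    simp only [Finset.mem_range, Finset.mem_filter, ← key]
    omega
  simp_rw [h1, Finset.mul_sum]
  rw [Finset.sum_comm, altFloorSum]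
  refine Finset.sum_congr rfl fun j _ => ?_
  have hT : (w - (j + 1)) / (2 * j + 1) ≤ n := (Nat.div_le_self _ _).trans (by omega)
  simp_rw [mul_ite, mul_zero]
  rw [← Finset.sum_filter]
  have : (Finset.range n).filter (fun m => m < (w - (j + 1)) / (2 * j + 1)) =
      Finset.range ((w - (j + 1)) / (2 * j + 1)) := by
    ext m; simp only [Finset.mem_range, Finset.mem_filter]; omega
  rw [this, ← Finset.sum_mul, Finset.sum_range_sub (fun m : ℕ => (m : ℝ) ^ p)]
  simp [hp, mul_comm]

lemma sum_one_sub_squareWave_natCast {p w n : ℕ} (hp : p ≠ 0) (hn : w < n) :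
    ∑ m ∈ Finset.range n, (((m + 1 : ℕ) : ℝ) ^ p - (m : ℝ) ^ p) *
      (1 - squareWave (m + 1) w) = altFloorSum p (w + 1) + altFloorSum p w := by
  rw [← sum_neg_one_pow_eq_altFloorSum hp hn, ← sum_neg_one_pow_eq_altFloorSum hp hn.le,
    ← Finset.sum_add_distrib]
  refine Finset.sum_congr rfl fun m _ => ?_
  have h1 : ((w : ℤ) + (m + 1 : ℕ) + 1) / (2 * (m + 1 : ℕ) + 1) =
    (((w + 1 + m + 1) / (2 * m + 3) : ℕ) : ℤ) := by push_cast; congr 1; ring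
  have h2 : ((w : ℤ) + (m + 1 : ℕ)) / (2 * (m + 1 : ℕ) + 1) =
    (((w + m + 1) / (2 * m + 3) : ℕ) : ℤ) := by push_cast; congr 1
  rw [squareWave, h1, h2, zpow_natCast, zpow_natCast]
  ring

/-- The value of `∑ ((m + 1) ^ p - m ^ p) * (1 - squareWave (m + 1) y)` over all `m`. -/
noncomputable def waveMoment (p : ℕ) (y : ℤ) : ℝ :=
  altFloorSum p ((max y (-1 - y)).toNat + 1) + altFloorSum p (max y (-1 - y)).toNat

/-- Evenness about `-1/2` folds `y` onto the nonnegative integer `max y (-1 - y)`, which is less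
than `n`. -/
lemma sum_one_sub_squareWave {p n : ℕ} {y : ℤ} (hp : p ≠ 0) (hn : |y| < n) :
    ∑ m ∈ Finset.range n, (((m + 1 : ℕ) : ℝ) ^ p - (m : ℝ) ^ p) *
      (1 - squareWave (m + 1) y) = waveMoment p y := by
  have h : ∀ m, squareWave m y = squareWave m ((max y (-1 - y)).toNat : ℤ) := by
    intro m
    rw [Int.toNat_of_nonneg (by omega)]
    rcases max_choice y (-1 - y) with h | h <;> rw [h]
    rw [squareWave_neg_one_sub]
  simp_rw [h]
  rw [abs_lt] at hn
  exact sum_one_sub_squareWave_natCast hp (by omega)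

/-! ### Asymptotics of the floor sums -/

lemma altFloorSum_eq_tsum {p : ℕ} (hp : p ≠ 0) (w : ℕ) :
    HasSum (fun j : ℕ => (-1 : ℝ) ^ j * (((w - (j + 1)) / (2 * j + 1) : ℕ) : ℝ) ^ p)
      (altFloorSum p w) := by
  refine hasSum_sum_of_ne_finset_zero fun j hj => ?_
  rw [Finset.mem_range, not_lt] at hj
  rw [Nat.sub_eq_zero_of_le (by omega)]
  simp [hp]

/-- The floors decrease in `j`, so the alternating tail is at most its first term. After division by
`w ^ p` the bound is uniform in `w`, which justifies the termwise limit even for `p = 1`, where the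
limiting series converges only conditionally. -/
lemma abs_altFloorSum_sub_le {p : ℕ} (hp : p ≠ 0) (w K : ℕ) :
    |altFloorSum p w - ∑ j ∈ Finset.range K,
      (-1 : ℝ) ^ j * (((w - (j + 1)) / (2 * j + 1) : ℕ) : ℝ) ^ p| ≤ (w : ℝ) ^ p / (2 * K + 1) := by
  have hs : Summable fun j : ℕ => (((w - (j + 1)) / (2 * j + 1) : ℕ) : ℝ) ^ p := by
    refine summable_of_ne_finset_zero (s := Finset.range w) fun j hj => ?_
    rw [Finset.mem_range, not_lt] at hj
    rw [Nat.sub_eq_zero_of_le (by omega)]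
    simp [hp]
  have ha : Antitone fun j : ℕ => (((w - (j + 1)) / (2 * j + 1) : ℕ) : ℝ) ^ p := by
    intro i j hij
    dsimp only
    gcongr
  have := alternating_series_error_bound _ ha hs K
  rw [(altFloorSum_eq_tsum hp w).tsum_eq] at this
  refine this.trans ?_
  have h1 : (((w - (K + 1)) / (2 * K + 1) : ℕ) : ℝ) ≤ w / (2 * K + 1) := by
    refine Nat.cast_div_le.trans ?_
    push_cast
    gcongr
    omega
  calc _ ≤ ((w : ℝ) / (2 * K + 1)) ^ p := by gcongr
    _ = (w : ℝ) ^ p / (2 * K + 1) ^ p := div_pow _ _ _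
    _ ≤ _ := by
      gcongr
      exact le_self_pow₀ (by linarith [Nat.cast_nonneg (α := ℝ) K]) hp

lemma tendsto_floor_div (j : ℕ) :
    Tendsto (fun w : ℕ => (((w - (j + 1)) / (2 * j + 1) : ℕ) : ℝ) / w) atTop
      (𝓝 (1 / (2 * j + 1))) := by
  have hj : (0 : ℝ) < 2 * j + 1 := by positivity
  have hc : ∀ c : ℝ, Tendsto (fun w : ℕ => 1 / (2 * (j : ℝ) + 1) - c / w) atTop
      (𝓝 (1 / (2 * j + 1))) := fun c => by
    simpa using tendsto_const_nhds.sub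
      ((tendsto_const_nhds (x := c)).div_atTop tendsto_natCast_atTop_atTop)
  -- The shift by `j + 1` and the rounding lose at most `3j + 1 ≤ 2(2j + 1)` in the numerator, hence
  -- the constant 2.
  refine tendsto_of_tendsto_of_tendsto_of_le_of_le' (hc 2) (hc 0) ?_ ?_
  · filter_upwards [eventually_gt_atTop 0] with w hw
    have hw' : (0 : ℝ) < w := by exact_mod_cast hw
    rw [le_div_iff₀ hw', sub_mul, div_mul_cancel₀ _ hw'.ne']
    have h : w ≤ (2 * j + 1) * ((w - (j + 1)) / (2 * j + 1)) + 2 * (2 * j + 1) := by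
      have := Nat.div_add_mod (w - (j + 1)) (2 * j + 1)
      have := Nat.mod_lt (w - (j + 1)) (show 0 < 2 * j + 1 by omega)
      omega
    have h' : (w : ℝ) ≤ (2 * j + 1) * (((w - (j + 1)) / (2 * j + 1) : ℕ) : ℝ) + 2 * (2 * j + 1) := by
      exact_mod_cast h
    rw [sub_le_iff_le_add, one_div_mul_eq_div, div_le_iff₀ hj]
    linarith
  · filter_upwards [eventually_gt_atTop 0] with w hw
    have hw' : (0 : ℝ) < w := by exact_mod_cast hw
    rw [div_le_iff₀ hw', zero_div, sub_zero, one_div_mul_eq_div]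
    refine Nat.cast_div_le.trans ?_
    push_cast
    gcongr
    omega

lemma tendsto_altFloorSum_div {p : ℕ} (hp : p ≠ 0) {c : ℝ}
    (hc : Tendsto (fun K => ∑ j ∈ Finset.range K, (-1 : ℝ) ^ j * (1 / (2 * (j : ℝ) + 1)) ^ p)
      atTop (𝓝 c)) :
    Tendsto (fun w : ℕ => altFloorSum p w / (w : ℝ) ^ p) atTop (𝓝 c) := by
  rw [Metric.tendsto_nhds]
  intro ε hε
  have hK : Tendsto (fun K : ℕ => 1 / (2 * (K : ℝ) + 1)) atTop (𝓝 0) := by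
    refine tendsto_const_nhds.div_atTop (tendsto_atTop_add_const_right _ _ ?_)
    exact tendsto_natCast_atTop_atTop.const_mul_atTop two_pos
  obtain ⟨K, hK1, hK2⟩ := ((hK.eventually (gt_mem_nhds (show 0 < ε / 3 by positivity))).and
    ((Metric.tendsto_nhds.1 hc) (ε / 3) (by positivity))).exists
  have hw : Tendsto (fun w : ℕ => ∑ j ∈ Finset.range K,
      (-1 : ℝ) ^ j * ((((w - (j + 1)) / (2 * j + 1) : ℕ) : ℝ) / w) ^ p) atTop
      (𝓝 (∑ j ∈ Finset.range K, (-1 : ℝ) ^ j * (1 / (2 * (j : ℝ) + 1)) ^ p)) :=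
    tendsto_finsetSum _ fun j _ => ((tendsto_floor_div j).pow p).const_mul _
  filter_upwards [(Metric.tendsto_nhds.1 hw) (ε / 3) (by positivity), eventually_gt_atTop 0]
    with w hw1 hw0
  have hwp : (0 : ℝ) < (w : ℝ) ^ p := by positivity
  have h1 := abs_altFloorSum_sub_le hp w K
  have h2 : |altFloorSum p w / (w : ℝ) ^ p - ∑ j ∈ Finset.range K,
      (-1 : ℝ) ^ j * ((((w - (j + 1)) / (2 * j + 1) : ℕ) : ℝ) / w) ^ p| ≤ 1 / (2 * K + 1) := by
    simp_rw [div_pow, ← mul_div_assoc, ← Finset.sum_div, ← sub_div]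
    rw [abs_div, abs_of_pos hwp, div_le_iff₀ hwp]
    exact h1.trans_eq (by ring)
  rw [Real.dist_eq] at *
  rw [abs_lt] at *
  rw [abs_le] at h2
  constructor <;> linarith [hK2.1, hK2.2, hw1.1, hw1.2, h2.1, h2.2]

lemma tendsto_waveMoment_div {p : ℕ} (hp : p ≠ 0) {c : ℝ}
    (hc : Tendsto (fun K => ∑ j ∈ Finset.range K, (-1 : ℝ) ^ j * (1 / (2 * (j : ℝ) + 1)) ^ p)
      atTop (𝓝 c)) :
    Tendsto (fun y : ℤ => waveMoment p y / |(y : ℝ)| ^ p) cofinite (𝓝 (2 * c)) := by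
  have hA := tendsto_altFloorSum_div hp hc
  have hsucc : Tendsto (fun w : ℕ => ((w + 1 : ℕ) : ℝ) / w) atTop (𝓝 1) := by
    refine (tendsto_const_nhds.add (tendsto_const_nhds (x := (1 : ℝ)).div_atTop
      tendsto_natCast_atTop_atTop)).congr' ?_ |>.trans (by rw [add_zero (1 : ℝ)])
    filter_upwards [eventually_gt_atTop 0] with w hw
    push_cast
    field_simp
  have hA1 : Tendsto (fun w : ℕ => altFloorSum p (w + 1) / (w : ℝ) ^ p) atTop (𝓝 c) := by
    have := (hA.comp (tendsto_add_atTop_nat 1)).mul (hsucc.pow p)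
    rw [one_pow, mul_one] at this
    refine this.congr' ?_
    filter_upwards [eventually_gt_atTop 0] with w hw
    simp only [Function.comp, div_pow]
    field_simp
  have hA2 : Tendsto (fun w : ℕ => altFloorSum p w / ((w + 1 : ℕ) : ℝ) ^ p) atTop (𝓝 c) := by
    have := hA.mul ((hsucc.inv₀ one_ne_zero).pow p)
    rw [inv_one, one_pow, mul_one] at this
    refine this.congr' ?_
    filter_upwards [eventually_gt_atTop 0] with w hw
    simp only [inv_div, div_pow]
    field_simp
  rw [Int.cofinite_eq, tendsto_sup]
  constructor
  · have h : Tendsto (fun y : ℤ => (-1 - y).toNat) atBot atTop := by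
      refine tendsto_atTop.2 fun b => ?_
      filter_upwards [eventually_le_atBot (-1 - (b : ℤ))] with y hy
      omega
    -- For `y ≤ -1` the folded argument is `w = |y| - 1`, so the normalisation is by `w + 1`.
    have := ((hA.comp (tendsto_add_atTop_nat 1)).add hA2).comp h
    rw [← two_mul] at this
    refine this.congr' ?_
    filter_upwards [eventually_le_atBot (-1 : ℤ)] with y hy
    have h1 : max y (-1 - y) = -1 - y := by omega
    have h2 : (((-1 - y).toNat + 1 : ℕ) : ℝ) = |(y : ℝ)| := by
      rw [← Int.cast_abs, ← Int.cast_natCast]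
      congr 1
      rw [abs_of_nonpos (by omega)]
      omega
    simp only [Function.comp, waveMoment, h1, h2, add_div]
  · have h : Tendsto (fun y : ℤ => y.toNat) atTop atTop := by
      refine tendsto_atTop.2 fun b => ?_
      filter_upwards [eventually_ge_atTop (b : ℤ)] with y hy
      omega
    have := (hA1.add hA).comp h
    rw [← two_mul] at this
    refine this.congr' ?_
    filter_upwards [eventually_ge_atTop (0 : ℤ)] with y hy
    have h1 : max y (-1 - y) = y := by omega
    have h2 : ((y.toNat : ℕ) : ℝ) = |(y : ℝ)| := by
      rw [← Int.cast_abs, ← Int.cast_natCast]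
      congr 1
      rw [abs_of_nonneg (by omega)]
      omega
    simp only [Function.comp, waveMoment, h1, h2, add_div]

/-! ### The averaging operator of the simple random walk -/

/-- The translation operator `f ↦ f (· + a)` on functions on the integers. -/
def translationOp (a : ℤ) : (ℤ → ℝ) →ₗ[ℝ] (ℤ → ℝ) where
  toFun f y := f (y + a)
  map_add' _ _ := rfl
  map_smul' _ _ := rfl

lemma translationOp_pow_apply (a : ℤ) (n : ℕ) (f : ℤ → ℝ) (y : ℤ) :
    (translationOp a ^ n) f y = f (y + n * a) := by
  induction n generalizing y with
  | zero => simp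
  | succ n ih =>
    rw [pow_succ', Module.End.mul_apply]
    change (translationOp a ^ n) f (y + a) = _
    rw [ih]
    congr 1
    push_cast
    ring

/-- The transition operator of the simple symmetric random walk on the integers. -/
noncomputable def stepAvg : (ℤ → ℝ) →ₗ[ℝ] (ℤ → ℝ) :=
  (1 / 2 : ℝ) • (translationOp 1 + translationOp (-1))

lemma stepAvg_apply (f : ℤ → ℝ) (y : ℤ) : stepAvg f y = (f (y + 1) + f (y - 1)) / 2 := by
  change (1 / 2 : ℝ) * (f (y + 1) + f (y + -1)) = _
  rw [← sub_eq_add_neg]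
  ring

lemma stepAvg_pow_succ_apply (n : ℕ) (f : ℤ → ℝ) (y : ℤ) :
    (stepAvg ^ (n + 1)) f y = ((stepAvg ^ n) f (y + 1) + (stepAvg ^ n) f (y - 1)) / 2 := by
  rw [pow_succ', Module.End.mul_apply, stepAvg_apply]

lemma stepAvg_pow_succ_apply' (n : ℕ) (f : ℤ → ℝ) :
    (stepAvg ^ (n + 1)) f = (stepAvg ^ n) (stepAvg f) := by
  rw [pow_succ, Module.End.mul_apply]

/-- In `n` steps the walk moves at most `n`. This later allows the sum over levels to be truncated.
-/
lemma stepAvg_pow_congr {n : ℕ} {f g : ℤ → ℝ} {y : ℤ} (h : ∀ z, |z - y| ≤ n → f z = g z) :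
    (stepAvg ^ n) f y = (stepAvg ^ n) g y := by
  induction n generalizing y with
  | zero => exact h y (by simp)
  | succ n ih =>
    rw [stepAvg_pow_succ_apply, stepAvg_pow_succ_apply, ih, ih] <;>
    · intro z hz
      apply h
      rw [abs_le] at *
      push_cast
      omega

lemma stepAvg_pow_mono (n : ℕ) {f g : ℤ → ℝ} (h : ∀ z, f z ≤ g z) (y : ℤ) :
    (stepAvg ^ n) f y ≤ (stepAvg ^ n) g y := by
  induction n generalizing y with
  | zero => exact h y
  | succ n ih =>
    rw [stepAvg_pow_succ_apply, stepAvg_pow_succ_apply]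
    linarith [ih (y + 1), ih (y - 1)]

lemma stepAvg_pow_const (n : ℕ) (c : ℝ) (y : ℤ) : (stepAvg ^ n) (fun _ => c) y = c := by
  induction n generalizing y with
  | zero => rfl
  | succ n ih => rw [stepAvg_pow_succ_apply, ih, ih]; ring

lemma stepAvg_pow_reflect {f : ℤ → ℝ} {c : ℤ} {ε : ℝ} (h : ∀ y, f (c - y) = ε * f y) (n : ℕ)
    (y : ℤ) : (stepAvg ^ n) f (c - y) = ε * (stepAvg ^ n) f y := by
  induction n generalizing y with
  | zero => exact h y
  | succ n ih =>
    rw [stepAvg_pow_succ_apply, stepAvg_pow_succ_apply, show c - y + 1 = c - (y - 1) by ring,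
      show c - y - 1 = c - (y + 1) by ring, ih, ih]
    ring

/-- The two translations commute, so the binomial theorem applies. -/
lemma stepAvg_pow_eq_sum (n : ℕ) (f : ℤ → ℝ) (y : ℤ) :
    (stepAvg ^ n) f y =
      (∑ m ∈ Finset.range (n + 1), (n.choose m : ℝ) * f (y + m - (n - m : ℕ))) / 2 ^ n := by
  have hc : Commute (translationOp 1) (translationOp (-1)) := by
    ext f y
    change f (y + 1 + -1) = f (y + -1 + 1)
    congr 1
    ring
  rw [stepAvg, smul_pow, hc.add_pow, LinearMap.smul_apply, LinearMap.sum_apply, Pi.smul_apply,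
    Finset.sum_apply, smul_eq_mul, one_div, inv_pow, inv_mul_eq_div]
  congr 1
  refine Finset.sum_congr rfl fun m _ => ?_
  rw [← nsmul_eq_mul', LinearMap.smul_apply, Pi.smul_apply, nsmul_eq_mul, Module.End.mul_apply,
    translationOp_pow_apply, translationOp_pow_apply]
  congr 2
  ring

/-! ### First and second absolute moments of the simple walk -/

lemma stepAvg_pow_single_even (k : ℕ) :
    (stepAvg ^ (2 * k)) (fun y : ℤ => if y = 0 then 1 else 0) 0 = (k.centralBinom : ℝ) / 4 ^ k := by
  rw [stepAvg_pow_eq_sum, pow_mul, Finset.sum_eq_single k]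
  · rw [if_pos (by omega), Nat.centralBinom]
    norm_num
  · intro m hm hmk
    rw [Finset.mem_range] at hm
    rw [if_neg (by omega), mul_zero]
  · intro h
    exact absurd (Finset.mem_range.2 (by omega)) h

lemma stepAvg_pow_single_odd (k : ℕ) :
    (stepAvg ^ (2 * k + 1)) (fun y : ℤ => if y = 0 then 1 else 0) 0 = 0 := by
  rw [stepAvg_pow_eq_sum, Finset.sum_eq_zero, zero_div]
  intro m hm
  rw [Finset.mem_range] at hm
  rw [if_neg (by omega), mul_zero]

/-- Discrete Tanaka formula: `|y|` is harmonic off the origin, so `E|Y_n|` grows at each step by the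
probability that `Y_n = 0`. -/
lemma stepAvg_abs : stepAvg (fun y : ℤ => |(y : ℝ)|) =
    (fun y : ℤ => |(y : ℝ)|) + fun y : ℤ => if y = 0 then (1 : ℝ) else 0 := by
  ext y
  rw [stepAvg_apply, Pi.add_apply]
  split_ifs with h
  · subst h; norm_num
  · push_cast
    rcases lt_or_gt_of_ne h with h | h
    · have : (y : ℝ) ≤ -1 := by exact_mod_cast (by omega : y ≤ -1)
      rw [abs_of_nonpos (by linarith), abs_of_nonpos (by linarith), abs_of_nonpos (by linarith)]
      ring
    · have : (1 : ℝ) ≤ y := by exact_mod_cast h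
      rw [abs_of_nonneg (by linarith), abs_of_nonneg (by linarith), abs_of_nonneg (by linarith)]
      ring

lemma stepAvg_pow_abs (k : ℕ) :
    (stepAvg ^ (2 * k)) (fun y : ℤ => |(y : ℝ)|) 0 = 2 * k * (k.centralBinom : ℝ) / 4 ^ k ∧
    (stepAvg ^ (2 * k + 1)) (fun y : ℤ => |(y : ℝ)|) 0 =
      (2 * k + 1) * (k.centralBinom : ℝ) / 4 ^ k := by
  have hodd : ∀ k : ℕ, (stepAvg ^ (2 * k)) (fun y : ℤ => |(y : ℝ)|) 0 =
      2 * k * (k.centralBinom : ℝ) / 4 ^ k → (stepAvg ^ (2 * k + 1)) (fun y : ℤ => |(y : ℝ)|) 0 =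
      (2 * k + 1) * (k.centralBinom : ℝ) / 4 ^ k := fun k h => by
    rw [stepAvg_pow_succ_apply', stepAvg_abs, map_add, Pi.add_apply, h, stepAvg_pow_single_even]
    ring
  suffices h : (stepAvg ^ (2 * k)) (fun y : ℤ => |(y : ℝ)|) 0 =
      2 * k * (k.centralBinom : ℝ) / 4 ^ k from ⟨h, hodd k h⟩
  induction k with
  | zero => simp
  | succ k ih =>
    rw [show 2 * (k + 1) = (2 * k + 1) + 1 by ring, stepAvg_pow_succ_apply', stepAvg_abs, map_add,
      Pi.add_apply, hodd k ih, stepAvg_pow_single_odd, add_zero]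
    have h : ((k : ℝ) + 1) * (k + 1).centralBinom = 2 * (2 * k + 1) * k.centralBinom := by
      exact_mod_cast Nat.succ_mul_centralBinom_succ k
    push_cast
    rw [mul_assoc 2, h, pow_succ]
    ring

lemma stepAvg_pow_sq (n : ℕ) : (stepAvg ^ n) (fun y : ℤ => |(y : ℝ)| ^ 2) 0 = n := by
  induction n with
  | zero => simp
  | succ n ih =>
    have : stepAvg (fun y : ℤ => |(y : ℝ)| ^ 2) = (fun y : ℤ => |(y : ℝ)| ^ 2) + fun _ : ℤ => (1 : ℝ) := by
      ext y
      simp only [sq_abs, stepAvg_apply, Pi.add_apply]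
      push_cast
      ring
    rw [stepAvg_pow_succ_apply', this, map_add, Pi.add_apply, ih, stepAvg_pow_const]
    push_cast
    ring

/-- The square of the `k`-th term is the reciprocal of the Wallis product `W k`. -/
lemma tendsto_sqrt_mul_centralBinom :
    Tendsto (fun k : ℕ => √(2 * k + 1) * ((k.centralBinom : ℝ) / 4 ^ k)) atTop
      (𝓝 √(2 / Real.pi)) := by
  have h := (Real.Wallis.tendsto_W_nhds_pi_div_two.inv₀ (by positivity)).sqrt
  rw [inv_div] at h
  refine h.congr fun k => ?_
  rw [Real.Wallis.W_eq_factorial_ratio, inv_div]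
  have hc : (k.centralBinom : ℝ) = (2 * k).factorial / (k.factorial : ℝ) ^ 2 := by
    rw [eq_div_iff (by positivity), sq, ← mul_assoc]
    have := Nat.choose_mul_factorial_mul_factorial (show k ≤ 2 * k by omega)
    rw [show 2 * k - k = k by omega] at this
    exact_mod_cast this
  rw [Real.sqrt_eq_iff_mul_self_eq (by positivity) (by positivity), mul_mul_mul_comm,
    Real.mul_self_sqrt (by positivity), hc, pow_mul]
  norm_num
  field_simp
  rw [← pow_mul, mul_comm, pow_mul]
  norm_num

lemma tendsto_of_even_odd {u : ℕ → ℝ} {L : ℝ} (h0 : Tendsto (fun k => u (2 * k)) atTop (𝓝 L))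
    (h1 : Tendsto (fun k => u (2 * k + 1)) atTop (𝓝 L)) : Tendsto u atTop (𝓝 L) := by
  rw [tendsto_def] at *
  intro s hs
  obtain ⟨a, ha⟩ := mem_atTop_sets.1 (h0 s hs)
  obtain ⟨b, hb⟩ := mem_atTop_sets.1 (h1 s hs)
  refine mem_atTop_sets.2 ⟨2 * (a + b), fun n hn => ?_⟩
  rcases n.even_or_odd' with ⟨k, rfl | rfl⟩
  · exact ha k (by omega)
  · exact hb k (by omega)

lemma tendsto_stepAvg_pow_abs :
    Tendsto (fun n : ℕ => (stepAvg ^ n) (fun y : ℤ => |(y : ℝ)|) 0 / √n) atTop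
      (𝓝 √(2 / Real.pi)) := by
  have hr : Tendsto (fun k : ℕ => √(2 * k / (2 * k + 1))) atTop (𝓝 1) := by
    have : Tendsto (fun k : ℕ => 1 - 1 / (2 * (k : ℝ) + 1)) atTop (𝓝 (1 - 0)) := by
      refine tendsto_const_nhds.sub (tendsto_const_nhds.div_atTop
        (tendsto_atTop_add_const_right _ _ ?_))
      exact tendsto_natCast_atTop_atTop.const_mul_atTop two_pos
    have := this.sqrt
    rw [sub_zero, Real.sqrt_one] at this
    refine this.congr fun k => ?_
    congr 1
    field_simp
    ring
  refine tendsto_of_even_odd ?_ ?_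
  · have := hr.mul tendsto_sqrt_mul_centralBinom
    rw [one_mul] at this
    refine this.congr' ?_
    filter_upwards [eventually_gt_atTop 0] with k hk
    have : (0 : ℝ) < k := by exact_mod_cast hk
    rw [(stepAvg_pow_abs k).1, Real.sqrt_div (by positivity)]
    have h1 : √(2 * (k : ℝ)) * √(2 * k) = 2 * k := Real.mul_self_sqrt (by positivity)
    have h2 : 0 < √(2 * (k : ℝ)) := by positivity
    have h3 : 0 < √(2 * (k : ℝ) + 1) := by positivity
    push_cast
    generalize √(2 * (k : ℝ)) = s at *
    generalize √(2 * (k : ℝ) + 1) = t at *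
    rw [← h1]
    field_simp
  · refine tendsto_sqrt_mul_centralBinom.congr fun k => ?_
    rw [(stepAvg_pow_abs k).2]
    have h1 : √(2 * (k : ℝ) + 1) * √(2 * k + 1) = 2 * k + 1 := Real.mul_self_sqrt (by positivity)
    have h2 : 0 < √(2 * (k : ℝ) + 1) := by positivity
    push_cast
    generalize √(2 * (k : ℝ) + 1) = t at *
    rw [← h1]
    field_simp

/-! ### Averaging asymptotically proportional functions -/

lemma exists_abs_sub_le_of_tendsto_cofinite {H V : ℤ → ℝ} {L : ℝ} (hV : ∀ᶠ y in cofinite, 0 < V y)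
    (hV0 : ∀ y, 0 ≤ V y) (h : Tendsto (fun y => H y / V y) cofinite (𝓝 L)) {ε : ℝ} (hε : 0 < ε) :
    ∃ C, ∀ y, |H y - L * V y| ≤ ε * V y + C := by
  have hf := ((Metric.tendsto_nhds.1 h) ε hε).and hV
  rw [eventually_cofinite] at hf
  obtain ⟨C, hC⟩ := (hf.image fun y => |H y - L * V y|).bddAbove
  refine ⟨max C 0, fun y => ?_⟩
  have hVy := mul_nonneg hε.le (hV0 y)
  by_cases hy : dist (H y / V y) L < ε ∧ 0 < V y
  · have h1 := hy.1
    rw [Real.dist_eq, div_sub' hy.2.ne', abs_div, abs_of_pos hy.2, div_lt_iff₀ hy.2,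
      mul_comm (V y)] at h1
    linarith [le_max_right C 0]
  · have := hC ⟨y, hy, rfl⟩
    linarith [le_max_left C 0]

/-- A function asymptotically proportional to `V` has an average proportional to that of `V`. -/
lemma tendsto_stepAvg_pow_div {H V : ℤ → ℝ} {L : ℝ} (hV : ∀ᶠ y in cofinite, 0 < V y)
    (hV0 : ∀ y, 0 ≤ V y) (h : Tendsto (fun y => H y / V y) cofinite (𝓝 L))
    (hE : Tendsto (fun n : ℕ => (stepAvg ^ n) V 0) atTop atTop) :
    Tendsto (fun n : ℕ => (stepAvg ^ n) H 0 / (stepAvg ^ n) V 0) atTop (𝓝 L) := by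
  rw [Metric.tendsto_nhds]
  intro ε hε
  obtain ⟨C, hC⟩ := exists_abs_sub_le_of_tendsto_cofinite hV hV0 h (half_pos hε)
  -- The additive constant `C` is absorbed once the average of `V` exceeds `C / (ε / 2)`.
  filter_upwards [hE.eventually_gt_atTop 0, hE.eventually_gt_atTop (C / (ε / 2))] with n h0 h1
  have hlin : ∀ a c : ℝ, (stepAvg ^ n) (a • V + fun _ => c) 0 = a * (stepAvg ^ n) V 0 + c := by
    intro a c
    rw [map_add, map_smul, Pi.add_apply, Pi.smul_apply, stepAvg_pow_const, smul_eq_mul]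
  have hup := stepAvg_pow_mono n (f := H) (g := (L + ε / 2) • V + fun _ => C)
    (fun z => by
      have := (abs_le.1 (hC z)).2
      simp only [Pi.add_apply, Pi.smul_apply, smul_eq_mul]
      linarith) 0
  have hlo := stepAvg_pow_mono n (g := H) (f := (L - ε / 2) • V + fun _ => -C)
    (fun z => by
      have := (abs_le.1 (hC z)).1
      simp only [Pi.add_apply, Pi.smul_apply, smul_eq_mul]
      linarith) 0
  rw [hlin] at hup hlo
  rw [div_lt_iff₀ (by positivity)] at h1
  rw [Real.dist_eq, div_sub' h0.ne', abs_div, abs_of_pos h0, div_lt_iff₀ h0, abs_lt]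
  constructor <;> linarith

/-! ### Pathwise properties of the reflected walk and its maximum -/

section Pathwise

variable {Ω Ω' : Type*}

lemma weakWalk_congr {X : ℕ → Ω → ℤ} {Y : ℕ → Ω' → ℤ} {ω : Ω} {ω' : Ω'} {j : ℕ}
    (h : ∀ i ≤ j, X i ω = Y i ω') : weakWalk X j ω = weakWalk Y j ω' := by
  induction j with
  | zero => exact h 0 le_rfl
  | succ j ih => rw [weakWalk, weakWalk, ih fun i hi => h i (by omega), h _ le_rfl]

lemma weakMax_lt_iff {X : ℕ → Ω → ℤ} {n : ℕ} {ω : Ω} {m : ℤ} :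
    weakMax X n ω < m ↔ ∀ j ≤ n, weakWalk X j ω < m := by
  simp [weakMax, Finset.sup'_lt_iff]

lemma weakMax_congr {X : ℕ → Ω → ℤ} {Y : ℕ → Ω' → ℤ} {ω : Ω} {ω' : Ω'} {n : ℕ}
    (h : ∀ i ≤ n, X i ω = Y i ω') : weakMax X n ω = weakMax Y n ω' := by
  rw [weakMax, weakMax]
  refine Finset.sup'_congr _ rfl fun j hj => weakWalk_congr fun i hi => h i ?_
  rw [Finset.mem_range] at hj
  omega

lemma weakMax_succ_lt_iff {X : ℕ → Ω → ℤ} {n : ℕ} {ω : Ω} {m : ℤ} :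
    weakMax X (n + 1) ω < m ↔ weakMax X n ω < m ∧ weakWalk X (n + 1) ω < m := by
  simp only [weakMax_lt_iff]
  refine ⟨fun h => ⟨fun j hj => h j (by omega), h _ le_rfl⟩, fun h j hj => ?_⟩
  rcases Nat.lt_succ_iff_lt_or_eq.1 (Nat.lt_succ_of_le hj) with h1 | rfl
  · exact h.1 j (by omega)
  · exact h.2

lemma weakWalk_nonneg {X : ℕ → Ω → ℤ} {ω : Ω} (h0 : X 0 ω = 0) (j : ℕ) : 0 ≤ weakWalk X j ω := by
  cases j with
  | zero => exact h0.ge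
  | succ j => exact le_max_right _ _

lemma weakMax_nonneg {X : ℕ → Ω → ℤ} {ω : Ω} (h0 : X 0 ω = 0) (n : ℕ) : 0 ≤ weakMax X n ω := by
  by_contra! h
  exact (weakWalk_nonneg h0 0).not_gt (weakMax_lt_iff.1 h 0 (by omega))

lemma weakWalk_le {X : ℕ → Ω → ℤ} {ω : Ω} (h0 : X 0 ω = 0) (h : ∀ i, X i ω ≤ 1) (j : ℕ) :
    weakWalk X j ω ≤ j := by
  induction j with
  | zero => exact h0.le
  | succ j ih =>
    rw [weakWalk]
    have := h (j + 1)
    push_cast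
    omega

lemma weakMax_le {X : ℕ → Ω → ℤ} {ω : Ω} (h0 : X 0 ω = 0) (h : ∀ i, X i ω ≤ 1) (n : ℕ) :
    weakMax X n ω ≤ n := by
  rw [← Int.lt_add_one_iff, weakMax_lt_iff]
  intro j hj
  have := weakWalk_le h0 h j
  omega

lemma pow_eq_sum_indicator {p n : ℕ} (hp : p ≠ 0) {k : ℤ} (h0 : 0 ≤ k) (hn : k ≤ n) :
    (k : ℝ) ^ p = ∑ m ∈ Finset.range n, (((m + 1 : ℕ) : ℝ) ^ p - (m : ℝ) ^ p) *
      (1 - if k < ((m + 1 : ℕ) : ℤ) then 1 else 0) := by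
  lift k to ℕ using h0
  have hf : (Finset.range n).filter (fun m => ¬ ((k : ℤ) < ((m + 1 : ℕ) : ℤ))) = Finset.range k := by
    ext m
    simp only [Finset.mem_filter, Finset.mem_range]
    omega
  have : ∀ m : ℕ, (((m + 1 : ℕ) : ℝ) ^ p - (m : ℝ) ^ p) *
      (1 - if (k : ℤ) < ((m + 1 : ℕ) : ℤ) then 1 else 0) =
      if ¬ ((k : ℤ) < ((m + 1 : ℕ) : ℤ)) then ((m + 1 : ℕ) : ℝ) ^ p - (m : ℝ) ^ p else 0 := by
    intro m
    split_ifs <;> simp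
  simp_rw [this]
  rw [← Finset.sum_filter, hf, Finset.sum_range_sub (fun m : ℕ => (m : ℝ) ^ p)]
  simp [hp]

end Pathwise

/-! ### Distribution and moments of the maximum -/

section Probability

variable {Ω : Type*} [MeasurableSpace Ω] {P : Measure Ω} {X : ℕ → Ω → ℤ}

lemma measurable_weakWalk (hmeas : ∀ i, Measurable (X i)) (j : ℕ) : Measurable (weakWalk X j) := by
  induction j with
  | zero => exact hmeas 0
  | succ j ih => exact (ih.add (hmeas _)).max measurable_const

lemma measurable_weakMax (hmeas : ∀ i, Measurable (X i)) (n : ℕ) : Measurable (weakMax X n) := by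
  have : weakMax X n = (Finset.range (n + 1)).sup' Finset.nonempty_range_add_one (weakWalk X) := by
    ext ω
    rw [weakMax, Finset.sup'_apply]
  rw [this]
  exact Finset.measurable_sup' _ fun j _ => measurable_weakWalk hmeas j

lemma indepFun_weakWalk_weakMax (hmeas : ∀ i, Measurable (X i)) (hindep : iIndepFun X P) (n : ℕ) :
    IndepFun (fun ω => (weakWalk X n ω, weakMax X n ω)) (X (n + 1)) P := by
  have h := hindep.indepFun_finset (Finset.range (n + 1)) {n + 1} (by simp) hmeas
  -- Coordinates padded by zero exhibit the walk and its maximum at time `n` as functions of `X 0,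
  -- …, X n` alone.
  let Y : ℕ → (Finset.range (n + 1) → ℤ) → ℤ := fun i x =>
    if hi : i ∈ Finset.range (n + 1) then x ⟨i, hi⟩ else 0
  have hY : ∀ i, Measurable (Y i) := by
    intro i
    by_cases hi : i ∈ Finset.range (n + 1)
    · simp only [Y, hi, dite_true]
      exact measurable_pi_apply _
    · simp only [Y, hi, dite_false]
      exact measurable_const
  have h2 := h.comp ((measurable_weakWalk hY n).prodMk (measurable_weakMax hY n))
    (measurable_pi_apply (⟨n + 1, by simp⟩ : ({n + 1} : Finset ℕ)))
  refine h2.congr (ae_of_all _ fun ω => ?_) (ae_of_all _ fun ω => rfl)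
  symm
  have hXY : ∀ i ≤ n, X i ω = Y i (fun i => X i ω) := by
    intro i hi
    have : i ∈ Finset.range (n + 1) := by simpa using Nat.lt_succ_of_le hi
    simp only [Y, this, dite_true]
  exact Prod.ext (weakWalk_congr hXY) (weakMax_congr hXY)

variable [IsProbabilityMeasure P]

lemma ae_eq_one_or_eq_neg_one {Y : Ω → ℤ} (hY : Measurable Y) (hpos : P {ω | Y ω = 1} = 1 / 2)
    (hneg : P {ω | Y ω = -1} = 1 / 2) : ∀ᵐ ω ∂P, Y ω = 1 ∨ Y ω = -1 := by
  have h1 : MeasurableSet {ω | Y ω = 1} := hY (measurableSet_singleton 1)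
  have h2 : MeasurableSet {ω | Y ω = -1} := hY (measurableSet_singleton (-1))
  have hd : Disjoint {ω | Y ω = 1} {ω | Y ω = -1} := by
    refine Set.disjoint_left.2 fun ω h h' => ?_
    rw [Set.mem_ofPred_eq] at h h'
    omega
  have hu : P ({ω | Y ω = 1} ∪ {ω | Y ω = -1}) = 1 := by
    rw [measure_union hd h2, hpos, hneg, ENNReal.add_halves]
  exact mem_ae_iff.2 ((prob_compl_eq_zero_iff (h1.union h2)).2 hu)

lemma integral_eq_average {Y : Ω → ℤ} {Z : Ω → ℤ × ℤ} (hY : Measurable Y) (hZ : Measurable Z)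
    (hpos : P {ω | Y ω = 1} = 1 / 2) (hneg : P {ω | Y ω = -1} = 1 / 2) (hind : IndepFun Z Y P)
    {H : ℤ × ℤ → ℤ → ℝ} {C : ℝ} (hH : ∀ z y, |H z y| ≤ C) :
    ∫ ω, H (Z ω) (Y ω) ∂P = ∫ ω, (H (Z ω) 1 + H (Z ω) (-1)) / 2 ∂P := by
  have hHm : ∀ y, Measurable fun ω => H (Z ω) y := fun y =>
    (Measurable.of_discrete (f := fun z => H z y)).comp hZ
  have hint : ∀ y, Integrable (fun ω => H (Z ω) y) P := fun y =>
    Integrable.of_bound (hHm y).aestronglyMeasurable C (ae_of_all _ fun ω => hH _ _)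
  have hI : ∀ y : ℤ, Measurable fun ω => if Y ω = y then (1 : ℝ) else 0 := fun y =>
    (Measurable.of_discrete (f := fun k : ℤ => if k = y then (1 : ℝ) else 0)).comp hY
  have hIH : ∀ y, Integrable (fun ω => H (Z ω) y * if Y ω = y then (1 : ℝ) else 0) P := fun y =>
    (hint y).mul_bdd (c := 1) (hI y).aestronglyMeasurable
      (ae_of_all _ fun ω => by split_ifs <;> simp)
  have hprod : ∀ y, P {ω | Y ω = y} = 1 / 2 →
      ∫ ω, H (Z ω) y * (if Y ω = y then (1 : ℝ) else 0) ∂P = (∫ ω, H (Z ω) y ∂P) / 2 := by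
    intro y hy
    have := (hind.comp (φ := fun z => H z y) (ψ := fun k : ℤ => if k = y then (1 : ℝ) else 0)
      Measurable.of_discrete Measurable.of_discrete).integral_mul_eq_mul_integral
      (hHm y).aestronglyMeasurable (hI y).aestronglyMeasurable
    have h2 : ∫ ω, (if Y ω = y then (1 : ℝ) else 0) ∂P = 1 / 2 := by
      have hset : MeasurableSet {ω | Y ω = y} := hY (measurableSet_singleton y)
      have := integral_indicator_one (μ := P) hset
      rw [measureReal_def, hy] at this
      simp only [Set.indicator, Set.mem_ofPred_eq, Pi.one_apply] at this
      rw [this]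
      norm_num
    simp only [Function.comp_def, Pi.mul_apply] at this
    rw [this, h2]
    ring
  calc ∫ ω, H (Z ω) (Y ω) ∂P
      = ∫ ω, (H (Z ω) 1 * (if Y ω = 1 then (1 : ℝ) else 0) +
          H (Z ω) (-1) * (if Y ω = -1 then (1 : ℝ) else 0)) ∂P := by
        refine integral_congr_ae ?_
        filter_upwards [ae_eq_one_or_eq_neg_one hY hpos hneg] with ω hω
        rcases hω with h | h <;> simp [h]
    _ = _ := by
        rw [integral_add (hIH 1) (hIH (-1)), hprod 1 hpos, hprod (-1) hneg, integral_div,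
          integral_add (hint 1) (hint (-1))]
        ring

/-- Averaging preserves oddness about `m`, so the value at `m` is its own negative. -/
lemma stepAvg_pow_squareWave_self (k m : ℕ) : (stepAvg ^ k) (squareWave m) m = 0 := by
  have := stepAvg_pow_reflect (f := squareWave m) (c := 2 * m) (ε := -1)
    (fun y => by rw [squareWave_two_mul_sub, neg_one_mul]) k m
  rw [show 2 * (m : ℤ) - m = m by ring] at this
  linarith

lemma stepAvg_pow_squareWave_neg_one (k m : ℕ) :
    (stepAvg ^ k) (squareWave m) (-1) = (stepAvg ^ k) (squareWave m) 0 := by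
  have := stepAvg_pow_reflect (f := squareWave m) (c := -1) (ε := 1)
    (fun y => by rw [squareWave_neg_one_sub, one_mul]) k 0
  simpa using this

lemma abs_stepAvg_pow_squareWave_le (k m : ℕ) (y : ℤ) : |(stepAvg ^ k) (squareWave m) y| ≤ 1 := by
  rw [abs_le]
  have h := fun z => abs_le.1 (abs_squareWave_le m z)
  constructor
  · have := stepAvg_pow_mono k (f := fun _ => -1) (fun z => (h z).1) y
    rwa [stepAvg_pow_const] at this
  · have := stepAvg_pow_mono k (g := fun _ => 1) (fun z => (h z).2) y
    rwa [stepAvg_pow_const] at this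

/-- One step of the killed, reflected walk trades one unit of `n` for one of `k`: the averaged wave
agrees at `-1` and `0`, so reflection goes unnoticed, and it vanishes at `m`, so killing costs
nothing. -/
lemma integral_stepAvg_pow_weakWalk (hmeas : ∀ i, Measurable (X i)) (hindep : iIndepFun X P)
    (hX0 : ∀ ω, X 0 ω = 0) (hpos : ∀ i, 1 ≤ i → P {ω | X i ω = 1} = 1 / 2)
    (hneg : ∀ i, 1 ≤ i → P {ω | X i ω = -1} = 1 / 2) {m : ℕ} (hm : m ≠ 0) (n k : ℕ) :
    ∫ ω, (if weakMax X n ω < m then (stepAvg ^ k) (squareWave m) (weakWalk X n ω) else 0) ∂P =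
      (stepAvg ^ (n + k)) (squareWave m) 0 := by
  induction n generalizing k with
  | zero =>
    have : ∀ ω, (if weakMax X 0 ω < m then (stepAvg ^ k) (squareWave m) (weakWalk X 0 ω) else 0) =
        (stepAvg ^ k) (squareWave m) 0 := by
      intro ω
      have h0 : weakWalk X 0 ω = 0 := hX0 ω
      rw [if_pos, h0]
      rw [weakMax_lt_iff]
      intro j hj
      obtain rfl : j = 0 := by omega
      omega
    simp [this]
  | succ n ih =>
    rw [show n + 1 + k = n + (k + 1) by ring, ← ih (k + 1)]
    set v := (stepAvg ^ k) (squareWave m) with hv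
    let H : ℤ × ℤ → ℤ → ℝ := fun z y =>
      if z.2 < m then v (z.1 + y) else 0
    have hae : ∀ᵐ ω ∂P, (if weakMax X (n + 1) ω < m then v (weakWalk X (n + 1) ω) else 0) =
        H (weakWalk X n ω, weakMax X n ω) (X (n + 1) ω) := by
      filter_upwards [ae_eq_one_or_eq_neg_one (hmeas (n + 1)) (hpos _ (by omega))
        (hneg _ (by omega))] with ω hω
      simp only [H]
      by_cases hM : weakMax X n ω < m
      · rw [if_pos hM]
        have hS := weakMax_lt_iff.1 hM n le_rfl
        have hS0 := weakWalk_nonneg (hX0 ω) n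
        have hv1 : v (weakWalk X (n + 1) ω) = v (weakWalk X n ω + X (n + 1) ω) := by
          rw [weakWalk]
          rcases max_choice (weakWalk X n ω + X (n + 1) ω) 0 with h | h
          · rw [h]
          · have : weakWalk X n ω + X (n + 1) ω = 0 ∨ weakWalk X n ω + X (n + 1) ω = -1 := by omega
            rcases this with h' | h' <;> rw [h, h']
            exact (stepAvg_pow_squareWave_neg_one k m).symm
        split_ifs with h
        · exact hv1
        · rw [weakMax_succ_lt_iff, not_and] at h
          have hge := h hM
          -- Steps are at most 1, so the first exit lands exactly on `m`.
          have : weakWalk X (n + 1) ω = m := by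
            rw [weakWalk] at hge ⊢
            omega
          rw [← hv1, this, hv, stepAvg_pow_squareWave_self]
      · rw [if_neg hM, if_neg fun h => hM (weakMax_succ_lt_iff.1 h).1]
    rw [integral_congr_ae hae, integral_eq_average (C := 1) (hmeas (n + 1))
      ((measurable_weakWalk hmeas n).prodMk (measurable_weakMax hmeas n)) (hpos _ (by omega))
      (hneg _ (by omega)) (indepFun_weakWalk_weakMax hmeas hindep n)]
    · refine integral_congr_ae (ae_of_all _ fun ω => ?_)
      simp only [H]
      split_ifs
      · rw [stepAvg_pow_succ_apply, ← sub_eq_add_neg]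
      · simp
    · intro z y
      simp only [H]
      split_ifs
      · exact abs_stepAvg_pow_squareWave_le k m _
      · simp

lemma integral_weakMax_lt (hmeas : ∀ i, Measurable (X i)) (hindep : iIndepFun X P)
    (hX0 : ∀ ω, X 0 ω = 0) (hpos : ∀ i, 1 ≤ i → P {ω | X i ω = 1} = 1 / 2)
    (hneg : ∀ i, 1 ≤ i → P {ω | X i ω = -1} = 1 / 2) {m : ℕ} (hm : m ≠ 0) (n : ℕ) :
    ∫ ω, (if weakMax X n ω < m then (1 : ℝ) else 0) ∂P = (stepAvg ^ n) (squareWave m) 0 := by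
  rw [← add_zero n, ← integral_stepAvg_pow_weakWalk hmeas hindep hX0 hpos hneg hm n 0, add_zero]
  refine integral_congr_ae (ae_of_all _ fun ω => ?_)
  dsimp only
  split_ifs with h
  · exact (squareWave_of_lt (weakWalk_nonneg (hX0 ω) n) (weakMax_lt_iff.1 h n le_rfl)).symm
  · rfl

lemma ae_weakMax_le (hmeas : ∀ i, Measurable (X i))
    (hX0 : ∀ ω, X 0 ω = 0) (hpos : ∀ i, 1 ≤ i → P {ω | X i ω = 1} = 1 / 2)
    (hneg : ∀ i, 1 ≤ i → P {ω | X i ω = -1} = 1 / 2) (n : ℕ) : ∀ᵐ ω ∂P, weakMax X n ω ≤ n := by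
  have : ∀ᵐ ω ∂P, ∀ i, X i ω ≤ 1 := by
    refine ae_all_iff.2 fun i => ?_
    rcases Nat.eq_zero_or_pos i with rfl | hi
    · exact ae_of_all _ fun ω => by rw [hX0]; norm_num
    · filter_upwards [ae_eq_one_or_eq_neg_one (hmeas i) (hpos i hi) (hneg i hi)] with ω hω
      omega
  filter_upwards [this] with ω hω
  exact weakMax_le (hX0 ω) hω n

lemma integrable_weakMax_pow (hmeas : ∀ i, Measurable (X i))
    (hX0 : ∀ ω, X 0 ω = 0) (hpos : ∀ i, 1 ≤ i → P {ω | X i ω = 1} = 1 / 2)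
    (hneg : ∀ i, 1 ≤ i → P {ω | X i ω = -1} = 1 / 2) (n p : ℕ) :
    Integrable (fun ω => (weakMax X n ω : ℝ) ^ p) P := by
  refine Integrable.of_bound (C := (n : ℝ) ^ p) ?_ ?_
  · exact ((Measurable.of_discrete (f := fun k : ℤ => (k : ℝ) ^ p)).comp
      (measurable_weakMax hmeas n)).aestronglyMeasurable
  · filter_upwards [ae_weakMax_le hmeas hX0 hpos hneg n] with ω hω
    have h0 : (0 : ℝ) ≤ weakMax X n ω := by exact_mod_cast weakMax_nonneg (hX0 ω) n
    have h1 : (weakMax X n ω : ℝ) ≤ n := by exact_mod_cast hω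
    rw [Real.norm_eq_abs, abs_of_nonneg (by positivity)]
    gcongr

/-- The moments of the maximum as averages of `waveMoment` over the simple random walk. -/
lemma integral_weakMax_pow (hmeas : ∀ i, Measurable (X i)) (hindep : iIndepFun X P)
    (hX0 : ∀ ω, X 0 ω = 0) (hpos : ∀ i, 1 ≤ i → P {ω | X i ω = 1} = 1 / 2)
    (hneg : ∀ i, 1 ≤ i → P {ω | X i ω = -1} = 1 / 2) {p : ℕ} (hp : p ≠ 0) (n : ℕ) :
    ∫ ω, (weakMax X n ω : ℝ) ^ p ∂P = (stepAvg ^ n) (waveMoment p) 0 := by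
  have hI : ∀ m : ℕ, Integrable
      (fun ω => if weakMax X n ω < ((m + 1 : ℕ) : ℤ) then (1 : ℝ) else 0) P := by
    intro m
    refine Integrable.of_bound (C := 1) ?_ (ae_of_all _ fun ω => by split_ifs <;> simp)
    exact ((Measurable.of_discrete (f := fun k : ℤ =>
      if k < ((m + 1 : ℕ) : ℤ) then (1 : ℝ) else 0)).comp
      (measurable_weakMax hmeas n)).aestronglyMeasurable
  have h1 : ∫ ω, (weakMax X n ω : ℝ) ^ p ∂P = ∫ ω, ∑ m ∈ Finset.range (n + 1),
      (((m + 1 : ℕ) : ℝ) ^ p - (m : ℝ) ^ p) *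
      (1 - if weakMax X n ω < ((m + 1 : ℕ) : ℤ) then 1 else 0) ∂P := by
    refine integral_congr_ae ?_
    filter_upwards [ae_weakMax_le hmeas hX0 hpos hneg n] with ω hω
    exact pow_eq_sum_indicator hp (weakMax_nonneg (hX0 ω) n) (by push_cast; omega)
  have h2 : (stepAvg ^ n) (waveMoment p) 0 = (stepAvg ^ n) (∑ m ∈ Finset.range (n + 1),
      (((m + 1 : ℕ) : ℝ) ^ p - (m : ℝ) ^ p) • ((fun _ => 1) - squareWave (m + 1))) 0 := by
    -- Only sites with `|z| ≤ n` matter, and for these the levels `m ≤ n` already give all of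
    -- `waveMoment`.
    refine stepAvg_pow_congr fun z hz => ?_
    rw [← sum_one_sub_squareWave hp (n := n + 1) (by rw [sub_zero] at hz; push_cast; omega),
      Finset.sum_apply]
    rfl
  have h3 : ∀ m ∈ Finset.range (n + 1), Integrable (fun ω => (((m + 1 : ℕ) : ℝ) ^ p - (m : ℝ) ^ p) *
      (1 - if weakMax X n ω < ((m + 1 : ℕ) : ℤ) then 1 else 0)) P :=
    fun m _ => ((integrable_const 1).sub (hI m)).const_mul _
  rw [h1, h2, integral_finsetSum _ h3, map_sum, Finset.sum_apply]
  refine Finset.sum_congr rfl fun m _ => ?_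
  rw [integral_const_mul, integral_sub (integrable_const 1) (hI m),
    integral_weakMax_lt hmeas hindep hX0 hpos hneg (Nat.succ_ne_zero m), map_smul, map_sub,
    Pi.smul_apply, Pi.sub_apply, stepAvg_pow_const]
  simp

end Probability

/-! ### The constants and the conclusion -/

lemma tendsto_sum_catalanConstant :
    Tendsto (fun K => ∑ j ∈ Finset.range K, (-1 : ℝ) ^ j * (1 / (2 * (j : ℝ) + 1)) ^ 2)
      atTop (𝓝 catalanConstant) := by
  have hs : Summable fun j : ℕ => (-1 : ℝ) ^ j / (2 * (j : ℝ) + 1) ^ 2 := by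
    refine Summable.of_norm_bounded
      ((summable_nat_add_iff 1).2 (Real.summable_one_div_nat_pow.2 one_lt_two)) fun j => ?_
    rw [norm_div, norm_pow, norm_neg, norm_one, one_pow, Real.norm_of_nonneg (by positivity)]
    push_cast
    gcongr
    linarith [Nat.cast_nonneg (α := ℝ) j]
  refine hs.hasSum.tendsto_sum_nat.congr fun K => Finset.sum_congr rfl fun j _ => ?_
  rw [div_pow, one_pow, mul_one_div]

lemma tendsto_sum_pi_div_four :
    Tendsto (fun K => ∑ j ∈ Finset.range K, (-1 : ℝ) ^ j * (1 / (2 * (j : ℝ) + 1)) ^ 1)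
      atTop (𝓝 (Real.pi / 4)) := by
  refine Real.tendsto_sum_pi_div_four.congr fun K => Finset.sum_congr rfl fun j _ => ?_
  rw [pow_one, mul_one_div]

/-- The partial sum `1 - 1/9` bounds the alternating series from below. Positivity is needed to turn
the limit of the ratio into an asymptotic equivalence. -/
lemma catalanConstant_pos : 0 < catalanConstant := by
  have h : Antitone fun j : ℕ => (1 / (2 * (j : ℝ) + 1)) ^ 2 := by
    intro i j hij
    dsimp only
    gcongr
  have := h.alternating_series_le_tendsto tendsto_sum_catalanConstant 1
  norm_num [Finset.sum_range_succ] at this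
  linarith

lemma tendsto_stepAvg_pow_waveMoment_one :
    Tendsto (fun n : ℕ => (stepAvg ^ n) (waveMoment 1) 0 / √n) atTop (𝓝 √(Real.pi / 2)) := by
  have hE := tendsto_stepAvg_pow_abs
  have hpos : 0 < √(2 / Real.pi) := by positivity
  have hsqrt : Tendsto (fun n : ℕ => √(n : ℝ)) atTop atTop :=
    Real.tendsto_sqrt_atTop.comp tendsto_natCast_atTop_atTop
  have hinf : Tendsto (fun n : ℕ => (stepAvg ^ n) (fun y : ℤ => |(y : ℝ)|) 0) atTop atTop := by
    refine (hE.pos_mul_atTop hpos hsqrt).congr' ?_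
    filter_upwards [eventually_gt_atTop 0] with n hn
    have : 0 < √(n : ℝ) := by positivity
    field_simp
  have hW := tendsto_waveMoment_div one_ne_zero tendsto_sum_pi_div_four
  simp only [pow_one] at hW
  have := tendsto_stepAvg_pow_div (V := fun y : ℤ => |(y : ℝ)|)
    (by
      filter_upwards [(Set.finite_singleton (0 : ℤ)).compl_mem_cofinite] with y hy
      exact abs_pos.2 (Int.cast_ne_zero.2 hy))
    (fun y => abs_nonneg _) hW hinf
  have h2 := this.mul hE
  have hc : 2 * (Real.pi / 4) * √(2 / Real.pi) = √(Real.pi / 2) := by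
    rw [← Real.sqrt_sq (show 0 ≤ 2 * (Real.pi / 4) by positivity), ← Real.sqrt_mul (by positivity)]
    congr 1
    field_simp
    norm_num
  rw [hc] at h2
  refine h2.congr' ?_
  filter_upwards [hinf.eventually_gt_atTop 0] with n hn
  field_simp

lemma tendsto_stepAvg_pow_waveMoment_two :
    Tendsto (fun n : ℕ => (stepAvg ^ n) (waveMoment 2) 0 / n) atTop (𝓝 (2 * catalanConstant)) := by
  have := tendsto_stepAvg_pow_div (V := fun y : ℤ => |(y : ℝ)| ^ 2)
    (by
      filter_upwards [(Set.finite_singleton (0 : ℤ)).compl_mem_cofinite] with y hy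
      have := abs_pos.2 (Int.cast_ne_zero (α := ℝ).2 hy)
      positivity)
    (fun y => by positivity) (tendsto_waveMoment_div two_ne_zero tendsto_sum_catalanConstant)
    (by simpa only [stepAvg_pow_sq] using tendsto_natCast_atTop_atTop)
  simpa only [stepAvg_pow_sq] using this

theorem mainTheorem1 {Ω : Type*} [MeasurableSpace Ω] (P : Measure Ω) [IsProbabilityMeasure P]
    (X : ℕ → Ω → ℤ) (hmeas : ∀ i, Measurable (X i)) (hindep : iIndepFun X P)
    (hX0 : ∀ ω, X 0 ω = 0)
    (hpos : ∀ i, 1 ≤ i → P {ω | X i ω = 1} = 1 / 2)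
    (hneg : ∀ i, 1 ≤ i → P {ω | X i ω = -1} = 1 / 2) :
    (∀ n, Integrable (fun ω => (weakMax X n ω : ℝ)) P) ∧
    (∀ n, Integrable (fun ω => (weakMax X n ω : ℝ) ^ 2) P) ∧
    ((fun n : ℕ => ∫ ω, (weakMax X n ω : ℝ) ∂P) ~[atTop]
      fun n : ℕ => Real.sqrt (Real.pi * n / 2)) ∧
    ((fun n : ℕ => ∫ ω, (weakMax X n ω : ℝ) ^ 2 ∂P) ~[atTop]
      fun n : ℕ => 2 * catalanConstant * n) ∧
    HasAbelLimit (1 / 2) (fun n : ℕ => ∫ ω, (weakMax X n ω : ℝ) ∂P) (Real.sqrt (Real.pi / 2)) ∧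
    HasAbelLimit 1 (fun n : ℕ => ∫ ω, (weakMax X n ω : ℝ) ^ 2 ∂P) (2 * catalanConstant) := by
  have h1 : Tendsto (fun n : ℕ => (∫ ω, (weakMax X n ω : ℝ) ∂P) / √n) atTop
      (𝓝 √(Real.pi / 2)) := by
    simpa only [← integral_weakMax_pow hmeas hindep hX0 hpos hneg one_ne_zero, pow_one]
      using tendsto_stepAvg_pow_waveMoment_one
  have h2 : Tendsto (fun n : ℕ => (∫ ω, (weakMax X n ω : ℝ) ^ 2 ∂P) / n) atTop
      (𝓝 (2 * catalanConstant)) := by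
    simpa only [← integral_weakMax_pow hmeas hindep hX0 hpos hneg two_ne_zero]
      using tendsto_stepAvg_pow_waveMoment_two
  have hG := catalanConstant_pos
  refine ⟨fun n => ?_, fun n => integrable_weakMax_pow hmeas hX0 hpos hneg n 2, ?_, ?_, ?_, ?_⟩
  · simpa only [pow_one] using integrable_weakMax_pow hmeas hX0 hpos hneg n 1
  · refine (isEquivalent_iff_tendsto_one ?_).2 ?_
    · filter_upwards [eventually_gt_atTop 0] with n hn
      positivity
    · have hc : 0 < √(Real.pi / 2) := by positivity
      have := h1.div_const √(Real.pi / 2)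
      rw [div_self hc.ne'] at this
      refine this.congr fun n => ?_
      rw [Pi.div_apply, div_div, ← Real.sqrt_mul (by positivity)]
      congr 2
      ring
  · refine (isEquivalent_iff_tendsto_one ?_).2 ?_
    · filter_upwards [eventually_gt_atTop 0] with n hn
      positivity
    · have := h2.div_const (2 * catalanConstant)
      rw [div_self (by positivity)] at this
      refine this.congr fun n => ?_
      rw [Pi.div_apply, div_div, mul_comm]
  · refine hasAbelLimit_of_tendsto (by norm_num) ?_
    simpa only [← Real.sqrt_eq_rpow] using h1
  · refine hasAbelLimit_of_tendsto zero_le_one ?_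
    simpa only [Real.rpow_one] using h2
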